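/- Conventions. A topological ring is an associative (not necessarily commutative) ring $R$ with unit, endowed with a Hausdorff topology for which addition and multiplication are continuous. A semitopological $R$-module is a unital left $R$-module $X$ endowed with a Hausdorff topology for which $X$ is a topological abelian group and the multiplication $R\times X\to X$, $(r,x)\mapsto r*x$, is separately continuous. A set $B\subseteq X$ is $R$-bounded if for every neighborhood $U\subseteq X$ of zero there is a neighborhood $V\subseteq R$ of zero with $V*B\subseteq U$. For a dense subset $D$ of a topological space $T$, the Cao–Moors game on $T$ is played by players I and II, who alternately choose nonempty open sets $U_0\supseteq V_0\supseteq U_1\supseteq V_1\supseteq\cdots$ (I chooses the $U_n$ and II the $V_n$); player II wins if $\bigcap_{n}U_n\neq\emptyset$ and every sequence $(x_n)_{n}\in\prod_{n}(V_n\cap D)$ has a cluster point in $T$, and otherwise player I wins. The space $T$ is strongly Baire if for some dense $D\subseteq T$ player I has no winning strategy in this game. Theorem. Let $X$ be a semitopological $R$-module over a topological ring $R$. 1. For any $R$-bounded set $B\subseteq X$, the multiplication map $R\times B\to X$, $(r,x)\mapsto r*x$, is (jointly) continuous. 2. If the space $R$ is strongly Baire, then every compact subset of $X$ is $R$-bounded.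 -/

import Mathlib

open Filter Topology

/-- A module `X` over a topological ring `R` is semitopological if its scalar multiplication
`R × X → X` is separately continuous. (That `R` is a Hausdorff topological ring and `X` a Hausdorff
topological abelian group is expressed by the usual Mathlib type classes.) -/
structure IsSemitopologicalModule (R X : Type*) [Ring R] [TopologicalSpace R]
    [AddCommGroup X] [TopologicalSpace X] [Module R X] : Prop where
  continuous_smul_left : ∀ r : R, Continuous (fun x : X => r • x)
  continuous_smul_right : ∀ x : X, Continuous (fun r : R => r • x)

/-- A subset `B` of an `R`-module `X` is `R`-bounded if for every neighborhood `U` of zero in `X`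
there is a neighborhood `V` of zero in `R` with `V * B ⊆ U`. -/
def IsRBounded (R : Type*) {X : Type*} [Ring R] [TopologicalSpace R]
    [AddCommGroup X] [TopologicalSpace X] [Module R X] (B : Set X) : Prop :=
  ∀ U ∈ 𝓝 (0 : X), ∃ V ∈ 𝓝 (0 : R), ∀ r ∈ V, ∀ x ∈ B, r • x ∈ U

namespace CaoMoors

variable {T : Type*} [TopologicalSpace T]

/-- A strategy of the first player assigns the next move `U n` to the finite list
`[V 0, …, V (n - 1)]` of the moves made so far by the second player. `move σ V n` is the `n`-th move
of the first player in the run where he follows `σ` and the second player plays `V`. -/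
def move (σ : List (Set T) → Set T) (V : ℕ → Set T) (n : ℕ) : Set T :=
  σ ((List.range n).map V)

/-- `U n` is a legal `n`-th move of the first player: a nonempty open set, contained in the
previous move `V (n - 1)` of the second player if `0 < n`. -/
def LegalI (U V : ℕ → Set T) (n : ℕ) : Prop :=
  IsOpen (U n) ∧ (U n).Nonempty ∧ ∀ m, n = m + 1 → U n ⊆ V m

/-- `V n` is a legal `n`-th move of the second player: a nonempty open subset of `U n`. -/
def LegalII (U V : ℕ → Set T) (n : ℕ) : Prop :=
  IsOpen (V n) ∧ (V n).Nonempty ∧ V n ⊆ U n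

/-- The winning condition of the second player in the Cao–Moors game with the dense set `D`. -/
def WinsII (D : Set T) (U V : ℕ → Set T) : Prop :=
  (⋂ n, U n).Nonempty ∧
    ∀ x : ℕ → T, (∀ n, x n ∈ V n ∩ D) → ∃ y : T, MapClusterPt y atTop x

/-- `σ` is a winning strategy of the first player in the Cao–Moors game with the dense set `D`:
it answers every legal finite sequence of moves of the second player by a legal move, and the second
player loses every infinite run in which he plays legally against `σ`. -/
def IsWinningStrategyI (D : Set T) (σ : List (Set T) → Set T) : Prop :=
  ∀ V : ℕ → Set T,
    (∀ n, (∀ m < n, LegalII (move σ V) V m) → LegalI (move σ V) V n) ∧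
    ((∀ n, LegalII (move σ V) V n) → ¬ WinsII D (move σ V) V)

end CaoMoors

/-- A topological space is strongly Baire if, for some dense subset `D`, the first player has no
winning strategy in the Cao–Moors game with the set `D`. -/
def StronglyBaire (T : Type*) [TopologicalSpace T] : Prop :=
  ∃ D : Set T, Dense D ∧ ¬ ∃ σ : List (Set T) → Set T, CaoMoors.IsWinningStrategyI D σ

/-! Part 2 is a double limit argument. If a compact `K` is not bounded, the game yields scalars `a
i` and pairs `z m` in `K × K` whose differences `d m` satisfy `a i • d m ∈ W'` for `i ≤ m` and `a i
• d m ∉ W` for `i > m`, where `W' ⊆ interior W`. With cluster points `b` of `a` (from the game) and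
`x` of `z` (from compactness), separate continuity puts `b • (x.1 - x.2)` both inside and outside
`interior W`, according to the order of the limits. -/

/-- Multiplication restricted to an `R`-bounded set is jointly continuous. -/
theorem IsRBounded.continuous_smul {R X : Type*}
    [Ring R] [TopologicalSpace R] [IsTopologicalRing R]
    [AddCommGroup X] [TopologicalSpace X] [IsTopologicalAddGroup X]
    [Module R X] (hX : IsSemitopologicalModule R X) {B : Set X} (hB : IsRBounded R B) :
    Continuous (fun p : R × B => p.1 • (p.2 : X)) := by
  rw [continuous_iff_continuousAt]
  rintro ⟨r₀, x₀⟩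
  -- Split `r • x = (r - r₀) • x + r₀ • x`; boundedness controls the first term uniformly in `x`.
  have h1 : Tendsto (fun p : R × B => (p.1 - r₀) • (p.2 : X)) (𝓝 (r₀, x₀)) (𝓝 0) := by
    intro U hU
    obtain ⟨V, hV, hVU⟩ := hB U hU
    have hc : Tendsto (fun p : R × B => p.1 - r₀) (𝓝 (r₀, x₀)) (𝓝 0) := by
      have : Continuous (fun p : R × B => p.1 - r₀) := by fun_prop
      simpa using this.tendsto (r₀, x₀)
    exact mem_map.2 <| mem_of_superset (mem_map.1 (hc hV)) fun p hp => hVU _ hp _ p.2.2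
  have h2 : Tendsto (fun p : R × B => r₀ • (p.2 : X)) (𝓝 (r₀, x₀)) (𝓝 (r₀ • (x₀ : X))) :=
    ((hX.continuous_smul_left r₀).comp
      (continuous_subtype_val.comp continuous_snd)).tendsto (r₀, x₀)
  have h3 := h1.add h2
  simp only [← add_smul, sub_add_cancel, zero_add] at h3
  exact h3

/-- In a nonempty strongly Baire space, every rule `F` that shrinks a nonempty open set, depending
on finitely many previously chosen points, admits a run along which the chosen points cluster. -/
theorem StronglyBaire.exists_run {T : Type*} [TopologicalSpace T] [Nonempty T]
    (hT : StronglyBaire T) (F : Set T → List T → Set T)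
    (hF : ∀ V A, IsOpen V → V.Nonempty → IsOpen (F V A) ∧ (F V A).Nonempty ∧ F V A ⊆ V) :
    ∃ (V : ℕ → Set T) (a : ℕ → T), (∀ n, a n ∈ V n) ∧
      (∀ n, V (n + 1) ⊆ F (V n) ((List.range (n + 1)).map a)) ∧ (∀ n, V (n + 1) ⊆ V n) ∧
      (∀ n, IsOpen (V n)) ∧ ∃ y, MapClusterPt y atTop a := by
  obtain ⟨D, hD, hσ⟩ := hT
  have hp : ∀ V : Set T, ∃ a, IsOpen V → V.Nonempty → a ∈ V ∩ D := by
    intro V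
    by_cases h : IsOpen V ∧ V.Nonempty
    · obtain ⟨a, ha⟩ := hD.inter_open_nonempty V h.1 h.2
      exact ⟨a, fun _ _ => ha⟩
    · exact ⟨Classical.arbitrary T, fun h1 h2 => absurd ⟨h1, h2⟩ h⟩
  choose p hp using hp
  -- Player I opens with the whole space, then applies `F` to the last reply, reading the chosen
  -- points off all replies so far.
  let σ : List (Set T) → Set T := fun l => l.getLast?.elim Set.univ fun V => F V (l.map p)
  have hσ0 : ∀ V, CaoMoors.move σ V 0 = Set.univ := fun V => by simp [CaoMoors.move, σ]
  have hσs : ∀ V n, CaoMoors.move σ V (n + 1) =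
      F (V n) ((List.range (n + 1)).map fun i => p (V i)) := fun V n => by
    have : ((List.range (n + 1)).map V).getLast? = some (V n) := by simp [List.range_succ]
    simp only [CaoMoors.move, σ, this, Option.elim_some, List.map_map, Function.comp_def]
  by_contra hcon
  refine hσ ⟨σ, fun V => ⟨?_, ?_⟩⟩
  · rintro (_ | n) hV
    · simp only [CaoMoors.LegalI, hσ0]
      exact ⟨isOpen_univ, Set.univ_nonempty, fun m hm => absurd hm (by omega)⟩
    · obtain ⟨ho, hne, -⟩ := hV n n.lt_succ_self
      simp only [CaoMoors.LegalI, hσs]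
      obtain ⟨h1, h2, h3⟩ := hF (V n) ((List.range (n + 1)).map fun i => p (V i)) ho hne
      refine ⟨h1, h2, fun m hm => ?_⟩
      obtain rfl : n = m := by omega
      exact h3
  · rintro hV ⟨-, hcl⟩
    have hmem : ∀ n, p (V n) ∈ V n ∩ D := fun n => hp _ (hV n).1 (hV n).2.1
    have hsub : ∀ n, V (n + 1) ⊆ F (V n) ((List.range (n + 1)).map fun i => p (V i)) :=
      fun n => hσs V n ▸ (hV (n + 1)).2.2
    exact hcon ⟨V, fun n => p (V n), fun n => (hmem n).1, hsub,
      fun n => (hsub n).trans (hF _ _ (hV n).1 (hV n).2.1).2.2, fun n => (hV n).1, hcl _ hmem⟩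

/-- If on some nonempty open set `V` of scalars the values `r • (x - y)` are controlled by those at
finitely many scalars, then `K` is absorbed by a neighborhood of zero. -/
theorem IsSemitopologicalModule.exists_nhds_smul_mem {R X : Type*}
    [Ring R] [TopologicalSpace R] [IsTopologicalRing R]
    [AddCommGroup X] [TopologicalSpace X] [IsTopologicalAddGroup X]
    [Module R X] (hX : IsSemitopologicalModule R X) {K : Set X} (hK : IsCompact K)
    {U W W' : Set X} (hW : W ∈ 𝓝 (0 : X)) (hW' : W' ∈ 𝓝 (0 : X))
    (hU : ∀ a ∈ W, ∀ b ∈ W, ∀ c ∈ W, a + b - c ∈ U)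
    {V : Set R} (hVo : IsOpen V) (hVne : V.Nonempty) (A : List R)
    (h : ∀ x ∈ K, ∀ y ∈ K, (∀ a ∈ A, a • (x - y) ∈ W') → ∀ r ∈ V, r • (x - y) ∈ W) :
    ∃ N ∈ 𝓝 (0 : R), ∀ r ∈ N, ∀ x ∈ K, r • x ∈ U := by
  obtain ⟨r₀, hr₀⟩ := hVne
  have hnhds : ∀ x ∈ K, {y | ∀ a ∈ A, a • (y - x) ∈ W'} ∈ 𝓝 x := by
    intro x _
    have : ∀ a ∈ {a | a ∈ A}, {y | a • (y - x) ∈ W'} ∈ 𝓝 x := by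
      intro a _
      have hc : Continuous fun y => a • (y - x) :=
        (hX.continuous_smul_left a).comp (continuous_id.sub continuous_const)
      exact hc.continuousAt.preimage_mem_nhds (by simpa using hW')
    filter_upwards [(biInter_mem A.finite_toSet).2 this] with y hy a ha
    exact Set.mem_iInter₂.1 hy a ha
  obtain ⟨t, htK, ht⟩ := hK.elim_nhds_subcover _ hnhds
  have hsmul : ∀ x ∈ t, {r : R | r • x ∈ W} ∈ 𝓝 (0 : R) := fun x _ =>
    (hX.continuous_smul_right x).continuousAt.preimage_mem_nhds (by simpa using hW)
  have hV : {r : R | r + r₀ ∈ V} ∈ 𝓝 (0 : R) :=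
    (continuous_id.add continuous_const).continuousAt.preimage_mem_nhds
      (hVo.mem_nhds (by simpa using hr₀))
  refine ⟨_, inter_mem hV ((biInter_finset_mem t).2 hsmul), ?_⟩
  rintro r ⟨hrV, hrt⟩ y hy
  obtain ⟨x, hxt, hxy⟩ := Set.mem_iUnion₂.1 (ht hy)
  -- Uses `r • y = (r + r₀) • (y - x) + r • x - r₀ • (y - x)`.
  have key := hU _ (h y hy x (htK x hxt) hxy _ hrV) _ (Set.mem_iInter₂.1 hrt x hxt) _
    (h y hy x (htK x hxt) hxy _ hr₀)
  convert key using 1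
  simp only [add_smul, smul_sub]
  abel

/-- Compact subsets of a semitopological module over a strongly Baire ring are bounded. -/
theorem IsCompact.isRBounded {R X : Type*}
    [Ring R] [TopologicalSpace R] [IsTopologicalRing R]
    [AddCommGroup X] [TopologicalSpace X] [IsTopologicalAddGroup X]
    [Module R X] (hX : IsSemitopologicalModule R X) (hR : StronglyBaire R)
    {K : Set X} (hK : IsCompact K) : IsRBounded R K := by
  intro U hU
  by_contra hcon
  obtain ⟨W, hW, hWc, hWU⟩ : ∃ W ∈ 𝓝 (0 : X), IsClosed W ∧
      ∀ a ∈ W, ∀ b ∈ W, ∀ c ∈ W, a + b - c ∈ U := by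
    have hc : Tendsto (fun q : X × X × X => q.1 + q.2.1 - q.2.2) (𝓝 (0, 0, 0)) (𝓝 0) := by
      have : Continuous (fun q : X × X × X => q.1 + q.2.1 - q.2.2) := by fun_prop
      simpa using this.tendsto (0, 0, 0)
    have hpre := hc hU
    rw [Filter.mem_map, nhds_prod_eq, nhds_prod_eq] at hpre
    obtain ⟨A, hA, B, hB, hAB⟩ := mem_prod_iff.1 hpre
    obtain ⟨C, hC, E, hE, hCE⟩ := mem_prod_iff.1 hB
    obtain ⟨W, hW, hWc, hWs⟩ :=
      exists_mem_nhds_isClosed_subset (inter_mem hA (inter_mem hC hE))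
    exact ⟨W, hW, hWc, fun a ha b hb c hc =>
      hAB (Set.mk_mem_prod (hWs ha).1 (hCE (Set.mk_mem_prod (hWs hb).2.1 (hWs hc).2.2)))⟩
  obtain ⟨W', hW', hWc', hWW'⟩ := exists_mem_nhds_isClosed_subset (interior_mem_nhds.2 hW)
  -- Otherwise finitely many scalars would control an open set of scalars, and `K` would be
  -- absorbed.
  have hosc : ∀ (V : Set R) (A : List R), ∃ q : X × X, IsOpen V → V.Nonempty →
      q ∈ K ×ˢ K ∧ (∀ a ∈ A, a • (q.1 - q.2) ∈ W') ∧ ∃ r ∈ V, r • (q.1 - q.2) ∉ W := by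
    intro V A
    by_contra! hq
    obtain ⟨hVo, hVne, -⟩ := hq 0
    refine hcon (hX.exists_nhds_smul_mem hK hW hW' hWU hVo hVne A fun x hx y hy hA r hr => ?_)
    exact (hq (x, y)).2.2 ⟨hx, hy⟩ hA r hr
  choose q hq using hosc
  have hcont : ∀ x : X, Continuous fun r : R => r • x := hX.continuous_smul_right
  obtain ⟨V, a, haV, hVF, hVs, hVo, b, hb⟩ := hR.exists_run
    (fun V A => {r | r ∈ V ∧ r • ((q V A).1 - (q V A).2) ∉ W}) (by
      intro V A hVo hVne
      obtain ⟨-, -, r, hr, hrW⟩ := hq V A hVo hVne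
      exact ⟨hVo.inter (hWc.isOpen_compl.preimage (hcont _)), ⟨r, hr, hrW⟩, fun _ h => h.1⟩)
  let z : ℕ → X × X := fun n => q (V n) ((List.range (n + 1)).map a)
  have hz : ∀ n, z n ∈ K ×ˢ K ∧ ∀ i ≤ n, a i • ((z n).1 - (z n).2) ∈ W' := fun n => by
    obtain ⟨h1, h2, -⟩ := hq (V n) ((List.range (n + 1)).map a) (hVo n) ⟨_, haV n⟩
    exact ⟨h1, fun i hi => h2 _ (List.mem_map_of_mem (List.mem_range.2 (by omega)))⟩
  have hVanti : Antitone V := antitone_nat_of_succ_le hVs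
  have haz : ∀ m n, m < n → a n • ((z m).1 - (z m).2) ∉ W := fun m n hmn =>
    (hVF m (hVanti hmn (haV n))).2
  obtain ⟨x, -, hx⟩ := (hK.prod hK).exists_mapClusterPt (u := z) (f := atTop)
    (tendsto_principal.2 (Eventually.of_forall fun n => (hz n).1))
  have hcont' : ∀ r : R, Continuous fun y : X × X => r • (y.1 - y.2) := fun r =>
    (hX.continuous_smul_left r).comp (continuous_fst.sub continuous_snd)
  -- Limit in `z` first, then in `a`; `h3` and `h4` take them in the opposite order.
  have h1 : ∀ i, a i • (x.1 - x.2) ∈ W' := fun i =>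
    (hWc'.preimage (hcont' (a i))).mem_of_mapClusterPt hx
      ((eventually_ge_atTop i).mono fun n hn => (hz n).2 i hn)
  have h2 : b • (x.1 - x.2) ∈ W' :=
    (hWc'.preimage (hcont _)).mem_of_mapClusterPt hb (Eventually.of_forall h1)
  have h3 : ∀ m, b • ((z m).1 - (z m).2) ∉ interior W := fun m =>
    (isOpen_interior.isClosed_compl.preimage (hcont _)).mem_of_mapClusterPt hb
      ((eventually_gt_atTop m).mono fun n hn h => haz m n hn (interior_subset h))
  have h4 : b • (x.1 - x.2) ∉ interior W :=
    (isOpen_interior.isClosed_compl.preimage (hcont' b)).mem_of_mapClusterPt hx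
      (Eventually.of_forall h3)
  exact h4 (hWW' h2)

theorem theorem3p2 {R X : Type*}
    [Ring R] [TopologicalSpace R] [IsTopologicalRing R] [T2Space R]
    [AddCommGroup X] [TopologicalSpace X] [IsTopologicalAddGroup X] [T2Space X]
    [Module R X] (hX : IsSemitopologicalModule R X) :
    (∀ B : Set X, IsRBounded R B → Continuous (fun p : R × B => p.1 • (p.2 : X))) ∧
    (StronglyBaire R → ∀ K : Set X, IsCompact K → IsRBounded R K) :=
  ⟨fun _ hB => hB.continuous_smul hX, fun hR _ hK => hK.isRBounded hX hR⟩
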